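/- **Finite-sample RKHS-norm bound for the untruncated KuLSIF estimator.** Let $P$ be a probability distribution on $\mathcal X\times\mathcal Z$, where $\mathcal X$ is a measurable space and $\mathcal Z$ a topological space with its Borel $\sigma$-algebra; let $P_Z$ be the $\mathcal Z$-marginal of $P$ and let $\Pi$ be a probability distribution (the prior) on $\mathcal Z$. Let $\mathcal H$ be a separable real RKHS of functions on $\mathcal Z$ with continuous kernel $k$, norm $\|\cdot\|$ and feature map $\phi(z)=k(z,\cdot)$, and assume $\|\phi(z)\|\le\kappa_1<\infty$ for $P_Z$-almost every $z$. Write $(a\otimes b)c=a\langle b,c\rangle$, $$m_\Pi=\mathbb E_{Z\sim\Pi}[\phi(Z)]\in\mathcal H,\qquad C=\mathbb E_{Z\sim P_Z}[\phi(Z)\otimes\phi(Z)].$$ Assume that $\Pi\ll P_Z$ and that the density ratio $r_0=d\Pi/dP_Z$ (that is, $\pi/p$ in terms of densities) has a version in $\mathcal H$, again denoted $r_0$, and that for given $\beta_1\in(0,1/2]$ and $\zeta_1<\infty$ there is $g_1\in\mathcal H$ with $r_0=C^{\beta_1}g_1$ and $\|g_1\|\le\zeta_1$. Here $C^{\beta}=\sum_\nu\nu^\beta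 P_\nu$ is defined by the spectral decomposition of $C$, with $P_\nu$ the orthogonal projection onto the $\nu$-eigenspace of $C$. Let $n\ge1$, let $(x_1,z_1),\dots,(x_n,z_n)$ be i.i.d. with law $P$, let $\hat m_\Pi$ be any (possibly data-dependent) random element of $\mathcal H$, let $\eta>0$, and put $$\hat C=\frac1n\sum_{i=1}^n\phi(z_i)\otimes\phi(z_i),\qquad \tilde r_\eta=(\hat C+\eta I)^{-1}\hat m_\Pi .$$ Then for every $\delta\in(0,2/e)$, with probability at least $1-\delta$, $$\|\tilde r_\eta-r_0\|\le\frac1\eta\left(\frac{4\kappa_1^2\,\|r_0\|\,\log(2/\delta)}{\sqrt n}+\|\hat m_\Pi-m_\Pi\|\right)+\eta^{\beta_1}\zeta_1 .$$ -/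

import Mathlib

open MeasureTheory ProbabilityTheory

noncomputable section

/-! ### Kernel features, kernel means and covariance operators

`H` is a real scalar-valued reproducing kernel Hilbert space of functions on `𝒵`
(Mathlib's `RKHS ℝ H 𝒵 ℝ`). -/

section Features

variable {𝒵 : Type*} (H : Type*) [NormedAddCommGroup H] [InnerProductSpace ℝ H]
  [CompleteSpace H] [RKHS ℝ H 𝒵 ℝ]

/-- The real-valued reproducing kernel `k(z, z')` of `H`. -/
def scalarKernel (z z' : 𝒵) : ℝ := RKHS.kernel H z z' 1

/-- The feature map `φ(z) = k(z, ·) ∈ H`. -/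
def featureMap (z : 𝒵) : H := RKHS.kerFun H z 1

/-- The kernel mean embedding `m_μ = E_μ[φ(Z)] ∈ H` (Bochner integral in `H`). -/
def kernelMean [MeasurableSpace 𝒵] (μ : Measure 𝒵) : H :=
  ∫ z, featureMap H z ∂μ

/-- The covariance operator `C = E_μ[φ(Z) ⊗ φ(Z)]` on `H` (Bochner integral of operators), where
`(a ⊗ b) c = ⟨b, c⟩ a`. -/
def covOperator [MeasurableSpace 𝒵] (μ : Measure 𝒵) : H →L[ℝ] H :=
  ∫ z, InnerProductSpace.rankOne ℝ (featureMap H z) (featureMap H z) ∂μ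

/-- The empirical covariance operator `Ĉ = n⁻¹ ∑ᵢ φ(zᵢ) ⊗ φ(zᵢ)`. -/
def empCovOperator {n : ℕ} (z : Fin n → 𝒵) : H →L[ℝ] H :=
  (n : ℝ)⁻¹ • ∑ i, InnerProductSpace.rankOne ℝ (featureMap H (z i)) (featureMap H (z i))

/-- `Ĉ + η I` is invertible for `η > 0`, so `Ring.inverse` in `kulsif` is the genuine inverse. -/
theorem isUnit_empCovOperator_add {n : ℕ} (z : Fin n → 𝒵) {η : ℝ} (hη : 0 < η) :
    IsUnit (empCovOperator H z + η • (1 : H →L[ℝ] H)) := by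
  refine ContinuousLinearMap.isUnit_of_forall_le_norm_inner_map _ (c := ⟨η, hη.le⟩) hη fun x => ?_
  have h : inner ℝ ((empCovOperator H z + η • (1 : H →L[ℝ] H)) x) x
      = (n : ℝ)⁻¹ * ∑ i, (inner ℝ (featureMap H (z i)) x) ^ 2 + η * ‖x‖ ^ 2 := by
    simp only [empCovOperator, add_apply, smul_apply, sum_apply,
      InnerProductSpace.rankOne_apply, inner_add_left, real_inner_smul_left, sum_inner,
      one_apply_eq_self, real_inner_self_eq_norm_sq, sq]
  have h0 : 0 ≤ (n : ℝ)⁻¹ * ∑ i, (inner ℝ (featureMap H (z i)) x) ^ 2 := by positivity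
  rw [h]
  refine le_trans ?_ (le_abs_self _)
  change ‖x‖ ^ 2 * η ≤ _
  linarith

variable {H}

/-- The untruncated KuLSIF estimator `r̃_η = (Ĉ + η I)⁻¹ m̂`. -/
def kulsif {n : ℕ} (η : ℝ) (z : Fin n → 𝒵) (mhat : H) : H :=
  Ring.inverse (empCovOperator H z + η • (1 : H →L[ℝ] H)) mhat

/-- `r` is a version of the density ratio `dQ / dμ`. With densities `q`, `p` of `Q`, `μ` with respect to a
common dominating measure, this is the function `q / p`. -/
def IsDensityRatio [MeasurableSpace 𝒵] (Q μ : Measure 𝒵) (r : 𝒵 → ℝ) : Prop :=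
  Q ≪ μ ∧ r =ᵐ[μ] fun z => (Q.rnDeriv μ z).toReal

end Features

/-- The fractional power `C ^ β`, `β > 0`, of a compact positive self-adjoint operator `C`, through
its spectral decomposition: `C ^ β x = ∑_ν ν ^ β P_ν x`, where `P_ν` is the orthogonal projection
onto the `ν`-eigenspace `ker (C - ν)`. (Reals `ν` that are not eigenvalues contribute `0`.) -/
def spectralPow {H : Type*} [NormedAddCommGroup H] [InnerProductSpace ℝ H] [CompleteSpace H]
    (C : H →L[ℝ] H) (β : ℝ) (x : H) : H :=
  ∑' ν : ℝ, (ν ^ β) • ((C - ν • (1 : H →L[ℝ] H)).ker).starProjection x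

end

/-! The population estimator `C w`, where `(C + η) w = r₀`, separates bias from variance. The bias
`C w - r₀ = -η w` scales the `ν`-component of `g₁` by `η ν ^ β₁ / (ν + η) ≤ η ^ β₁` in absolute
value (`Real.rpow_mul_div_add_le`). For the variance, a change of measure gives `m_Π = C r₀ = (C +
η) C w`, so `(Ĉ + η)(r̃ - C w) = (C - Ĉ) C w + (m̂ - m_Π)`; since `Ĉ ≥ 0`, inverting `Ĉ + η` costs
at most `1 / η`. The vector `C w` is deterministic with `‖C w‖ ≤ ‖r₀‖`, so `(C - Ĉ) C w` is an
average of i.i.d. centred vectors. A Hilbert-space Hoeffding inequality controls it, by the bound `E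
cosh ‖∑ Yᵢ‖ ≤ (cosh b) ^ n`; this is the only probabilistic input, and it does not involve `m̂`. -/

/-! ### Hoeffding's inequality in a Hilbert space. -/

section Hoeffding

/-- A chord bound for `t ↦ cosh √(a² + b² + 2abt)` on `[-1, 1]`. -/
theorem Real.cosh_le_of_sq_eq {a b t u : ℝ} (ht : |t| ≤ 1)
    (hu : u ^ 2 = a ^ 2 + b ^ 2 + 2 * (a * b) * t) :
    Real.cosh u ≤ Real.cosh a * Real.cosh b + t * (Real.sinh a * Real.sinh b) := by
  obtain ⟨ht1, ht2⟩ := abs_le.mp ht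
  -- `u ^ 2` is the convex combination of `(a ± b) ^ 2` with weights `(1 ± t) / 2`, and `cosh` is a
  -- power series in the square with nonnegative coefficients: compare termwise.
  have h1 := (Real.hasSum_cosh (a + b)).mul_left ((1 + t) / 2)
  have h2 := (Real.hasSum_cosh (a - b)).mul_left ((1 - t) / 2)
  have h3 := hasSum_le (fun k => ?_) (Real.hasSum_cosh u) (h1.add h2)
  · rw [Real.cosh_add, Real.cosh_sub] at h3
    linarith
  · have hconv := (convexOn_pow k).2 (Set.mem_Ici.2 (sq_nonneg (a + b)))
      (Set.mem_Ici.2 (sq_nonneg (a - b))) (show 0 ≤ (1 + t) / 2 by linarith)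
      (show 0 ≤ (1 - t) / 2 by linarith) (by ring)
    have hu' : u ^ 2 = ((1 + t) / 2) • (a + b) ^ 2 + ((1 - t) / 2) • (a - b) ^ 2 := by
      rw [hu]; simp only [smul_eq_mul]; ring
    beta_reduce at hconv
    rw [← hu'] at hconv
    simp only [smul_eq_mul] at hconv
    rw [pow_mul, pow_mul, pow_mul, ← mul_div_assoc, ← mul_div_assoc, ← add_div]
    gcongr

variable {H : Type*} [NormedAddCommGroup H] [InnerProductSpace ℝ H]

/-- Replacing `‖y‖ ^ 2` by `b ^ 2` in `‖x + y‖ ^ 2` only enlarges it; the chord bound then applies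
with `t = ⟨x, y⟩ / (‖x‖ b)`. As `c` is independent of `y`, the last term vanishes on averaging over
a centred `y`. -/
theorem exists_cosh_norm_add_le (x : H) {b : ℝ} (hb : 0 ≤ b) :
    ∃ c : ℝ, ∀ y : H, ‖y‖ ≤ b →
      Real.cosh ‖x + y‖ ≤ Real.cosh ‖x‖ * Real.cosh b + c * inner ℝ x y := by
  refine ⟨Real.sinh ‖x‖ * Real.sinh b / (‖x‖ * b), fun y hy => ?_⟩
  -- Here division by zero makes `c = 0`, and `x = 0` or `y = 0`.
  by_cases h0 : ‖x‖ * b = 0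
  · rcases mul_eq_zero.mp h0 with h | h
    · have hx : x = 0 := norm_eq_zero.mp h
      subst hx
      simpa [abs_of_nonneg hb] using hy
    · have hy0 : y = 0 := norm_eq_zero.mp (le_antisymm (hy.trans h.le) (norm_nonneg y))
      subst hy0
      simp [h]
  · have hpos : 0 < ‖x‖ * b := lt_of_le_of_ne (by positivity) (Ne.symm h0)
    have hu0 : 0 ≤ ‖x‖ ^ 2 + b ^ 2 + 2 * inner ℝ x y := by
      have := norm_add_sq_real x y
      have h2 : ‖y‖ ^ 2 ≤ b ^ 2 := by gcongr
      nlinarith [sq_nonneg ‖x + y‖]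
    have ht : |inner ℝ x y / (‖x‖ * b)| ≤ 1 := by
      rw [abs_div, abs_of_pos hpos, div_le_one hpos]
      exact (abs_real_inner_le_norm x y).trans (by gcongr)
    have key := Real.cosh_le_of_sq_eq (a := ‖x‖) (b := b)
      (u := √(‖x‖ ^ 2 + b ^ 2 + 2 * inner ℝ x y)) ht (by
        rw [Real.sq_sqrt hu0, mul_assoc 2, mul_div_cancel₀ _ h0])
    refine (Real.cosh_le_cosh.2 ?_).trans (key.trans (le_of_eq (by ring)))
    rw [abs_of_nonneg (norm_nonneg _), abs_of_nonneg (Real.sqrt_nonneg _)]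
    apply Real.le_sqrt_of_sq_le
    rw [norm_add_sq_real]
    have h2 : ‖y‖ ^ 2 ≤ b ^ 2 := by gcongr
    linarith

variable [CompleteSpace H] [SecondCountableTopology H] [MeasurableSpace H] [BorelSpace H]

theorem lintegral_cosh_norm_add_le (ν : Measure H) [IsProbabilityMeasure ν] {b : ℝ}
    (hν : ∀ᵐ y ∂ν, ‖y‖ ≤ b) (hmean : ∫ y, y ∂ν = 0) (x : H) :
    ∫⁻ y, ENNReal.ofReal (Real.cosh ‖x + y‖) ∂ν
      ≤ ENNReal.ofReal (Real.cosh ‖x‖) * ENNReal.ofReal (Real.cosh b) := by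
  obtain ⟨y₀, hy₀⟩ := hν.exists
  obtain ⟨c, hc⟩ := exists_cosh_norm_add_le x ((norm_nonneg y₀).trans hy₀)
  have hint : Integrable (fun y : H => y) ν :=
    Integrable.of_bound aestronglyMeasurable_id b hν
  have hint' : Integrable
      (fun y : H => Real.cosh ‖x‖ * Real.cosh b + c * inner ℝ x y) ν :=
    (integrable_const _).add ((hint.const_inner x).const_mul c)
  have hnonneg : 0 ≤ᵐ[ν] fun y : H => Real.cosh ‖x‖ * Real.cosh b + c * inner ℝ x y := by
    filter_upwards [hν] with y hy using (Real.cosh_pos _).le.trans (hc y hy)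
  calc ∫⁻ y, ENNReal.ofReal (Real.cosh ‖x + y‖) ∂ν
      ≤ ∫⁻ y, ENNReal.ofReal (Real.cosh ‖x‖ * Real.cosh b + c * inner ℝ x y) ∂ν := by
        apply lintegral_mono_ae
        filter_upwards [hν] with y hy using ENNReal.ofReal_le_ofReal (hc y hy)
    _ = ENNReal.ofReal (∫ y, (Real.cosh ‖x‖ * Real.cosh b + c * inner ℝ x y) ∂ν) :=
        (ofReal_integral_eq_lintegral_ofReal hint' hnonneg).symm
    _ = ENNReal.ofReal (Real.cosh ‖x‖) * ENNReal.ofReal (Real.cosh b) := by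
        rw [integral_add (integrable_const _) ((hint.const_inner x).const_mul c),
          integral_const, integral_const_mul c, integral_inner hint, hmean]
        simp [ENNReal.ofReal_mul (Real.cosh_pos _).le]

variable {Ω ι : Type*} [MeasurableSpace Ω] {μ : Measure Ω} [IsProbabilityMeasure μ]

/-- Each new summand is independent of the partial sum, so integrating it out first costs one factor
`cosh b`. -/
theorem lintegral_cosh_norm_sum_le {Y : ι → Ω → H} (hY : ∀ i, AEMeasurable (Y i) μ)
    (hindep : iIndepFun Y μ) {b : ℝ} (hb : ∀ i, ∀ᵐ ω ∂μ, ‖Y i ω‖ ≤ b)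
    (hmean : ∀ i, ∫ ω, Y i ω ∂μ = 0) (s : Finset ι) :
    ∫⁻ ω, ENNReal.ofReal (Real.cosh ‖∑ i ∈ s, Y i ω‖) ∂μ
      ≤ ENNReal.ofReal (Real.cosh b) ^ s.card := by
  classical
  induction s using Finset.induction_on with
  | empty => simp
  | insert j s hj ih =>
    have hS : AEMeasurable (fun ω => ∑ i ∈ s, Y i ω) μ :=
      Finset.aemeasurable_fun_sum s fun i _ => hY i
    have hind : IndepFun (fun ω => ∑ i ∈ s, Y i ω) (Y j) μ := by
      have := hindep.indepFun_finsetSum_of_notMem₀ hY hj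
      convert this using 1
      ext ω; simp
    have hprob : IsProbabilityMeasure (μ.map (Y j)) := Measure.isProbabilityMeasure_map (hY j)
    have hprobS : IsProbabilityMeasure (μ.map fun ω => ∑ i ∈ s, Y i ω) :=
      Measure.isProbabilityMeasure_map hS
    have hcont : Continuous fun p : H × H => ENNReal.ofReal (Real.cosh ‖p.1 + p.2‖) :=
      ENNReal.continuous_ofReal.comp (by fun_prop)
    have hcont' : Continuous fun x : H => ENNReal.ofReal (Real.cosh ‖x‖) :=
      ENNReal.continuous_ofReal.comp (by fun_prop)
    have hν : ∀ᵐ y ∂(μ.map (Y j)), ‖y‖ ≤ b :=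
      (ae_map_iff (hY j) (measurableSet_le measurable_norm measurable_const)).2 (hb j)
    have hm : ∫ y, y ∂(μ.map (Y j)) = 0 := by
      exact (integral_map (hY j) aestronglyMeasurable_id).trans (hmean j)
    calc ∫⁻ ω, ENNReal.ofReal (Real.cosh ‖∑ i ∈ insert j s, Y i ω‖) ∂μ
        = ∫⁻ ω, (fun p : H × H => ENNReal.ofReal (Real.cosh ‖p.1 + p.2‖))
            (∑ i ∈ s, Y i ω, Y j ω) ∂μ := by
          simp only [Finset.sum_insert hj, add_comm]
      _ = ∫⁻ p, ENNReal.ofReal (Real.cosh ‖p.1 + p.2‖)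
            ∂((μ.map fun ω => ∑ i ∈ s, Y i ω).prod (μ.map (Y j))) := by
          rw [← (indepFun_iff_map_prod_eq_prod_map_map hS (hY j)).1 hind,
            lintegral_map' hcont.measurable.aemeasurable (hS.prodMk (hY j))]
      _ = ∫⁻ x, ∫⁻ y, ENNReal.ofReal (Real.cosh ‖x + y‖) ∂(μ.map (Y j))
            ∂(μ.map fun ω => ∑ i ∈ s, Y i ω) :=
          lintegral_prod _ hcont.measurable.aemeasurable
      _ ≤ ∫⁻ x, ENNReal.ofReal (Real.cosh ‖x‖) * ENNReal.ofReal (Real.cosh b)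
            ∂(μ.map fun ω => ∑ i ∈ s, Y i ω) :=
          lintegral_mono fun x => lintegral_cosh_norm_add_le _ hν hm x
      _ = (∫⁻ ω, ENNReal.ofReal (Real.cosh ‖∑ i ∈ s, Y i ω‖) ∂μ)
            * ENNReal.ofReal (Real.cosh b) := by
          rw [lintegral_mul_const _ hcont'.measurable,
            lintegral_map' hcont'.measurable.aemeasurable hS]
      _ ≤ ENNReal.ofReal (Real.cosh b) ^ (insert j s).card := by
          rw [Finset.card_insert_of_notMem hj, pow_succ]
          gcongr

/-- **Hoeffding's inequality in a Hilbert space**, with Pinelis' constant. -/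
theorem measureReal_norm_sum_gt_le [Fintype ι] {Y : ι → Ω → H}
    (hY : ∀ i, AEMeasurable (Y i) μ)
    (hindep : iIndepFun Y μ) {b : ℝ} (hb : ∀ i, ∀ᵐ ω ∂μ, ‖Y i ω‖ ≤ b)
    (hmean : ∀ i, ∫ ω, Y i ω ∂μ = 0) {t : ℝ} (ht : 0 ≤ t) :
    μ.real {ω | b * √(Fintype.card ι) * t < ‖∑ i, Y i ω‖} ≤ 2 * Real.exp (-t ^ 2 / 2) := by
  rcases isEmpty_or_nonempty ι with hι | ⟨⟨i₀⟩⟩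
  · simp; positivity
  obtain ⟨ω₀, hω₀⟩ := (hb i₀).exists
  have hN : 0 < √(Fintype.card ι : ℝ) :=
    Real.sqrt_pos.2 (Nat.cast_pos.2 (Fintype.card_pos_iff.2 ⟨i₀⟩))
  -- The scaling `l` below divides by `b`, so `b = 0` is treated apart.
  rcases ((norm_nonneg _).trans hω₀).eq_or_lt with h0 | h0
  · have hz : ∀ᵐ ω ∂μ, ∀ i, ‖Y i ω‖ ≤ b := ae_all_iff.2 hb
    have : μ {ω | b * √(Fintype.card ι) * t < ‖∑ i, Y i ω‖} = 0 := by
      rw [measure_eq_zero_iff_ae_notMem]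
      filter_upwards [hz] with ω hω
      have : ∀ i, Y i ω = 0 := fun i =>
        norm_eq_zero.1 (le_antisymm ((hω i).trans h0.ge) (norm_nonneg _))
      simp [this, ← h0]
    rw [measureReal_def, this]
    simp; positivity
  set N : ℝ := (Fintype.card ι : ℝ) with hNdef
  -- This scaling sends the threshold `b √N t` to `t ^ 2` and makes `cosh (l b) ^ N ≤ exp (t ^ 2 /
  -- 2)`.
  set l : ℝ := t / (b * √N) with hl
  have hl0 : 0 ≤ l := by positivity
  have hmgf := lintegral_cosh_norm_sum_le (μ := μ) (Y := fun i ω => l • Y i ω) (b := l * b)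
    (fun i => (hY i).const_smul l)
    (hindep.comp (fun _ y => l • y) fun _ => measurable_const_smul l)
    (fun i => by
      filter_upwards [hb i] with ω hω
      rw [norm_smul, Real.norm_of_nonneg hl0]
      gcongr)
    (fun i => by rw [integral_smul, hmean i, smul_zero]) Finset.univ
  have hS : AEMeasurable (fun ω => ∑ i, l • Y i ω) μ :=
    Finset.aemeasurable_fun_sum _ fun i _ => (hY i).const_smul l
  have hcont : Continuous fun x : H => ENNReal.ofReal (Real.cosh ‖x‖) :=
      ENNReal.continuous_ofReal.comp (by fun_prop)
  -- The level comes from `exp (t ^ 2) / 2 ≤ cosh (t ^ 2)`.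
  have hmarkov := mul_meas_ge_le_lintegral₀
    (hcont.measurable.comp_aemeasurable hS) (ENNReal.ofReal (Real.exp (t ^ 2) / 2))
  have hsub : {ω | b * √N * t < ‖∑ i, Y i ω‖} ⊆
      {ω | ENNReal.ofReal (Real.exp (t ^ 2) / 2) ≤
        ((fun x : H => ENNReal.ofReal (Real.cosh ‖x‖)) ∘ fun ω => ∑ i, l • Y i ω) ω} := by
    intro ω hω
    simp only [Set.mem_ofPred_eq, Function.comp] at hω ⊢
    apply ENNReal.ofReal_le_ofReal
    have h1 : t ^ 2 ≤ ‖∑ i, l • Y i ω‖ := by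
      rw [← Finset.smul_sum, norm_smul, Real.norm_of_nonneg hl0]
      calc t ^ 2 = l * (b * √N * t) := by rw [hl]; field_simp
        _ ≤ _ := by gcongr
    rw [Real.cosh_eq]
    have := Real.exp_pos (-‖∑ i, l • Y i ω‖)
    have := Real.exp_le_exp.2 h1
    linarith
  have hfin : ENNReal.ofReal (Real.exp (t ^ 2) / 2) * μ {ω | b * √N * t < ‖∑ i, Y i ω‖}
      ≤ ENNReal.ofReal (Real.exp (t ^ 2 / 2)) := by
    refine (mul_le_mul_right (measure_mono hsub) _).trans (hmarkov.trans (hmgf.trans ?_))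
    rw [← ENNReal.ofReal_pow (Real.cosh_pos _).le]
    apply ENNReal.ofReal_le_ofReal
    calc Real.cosh (l * b) ^ (Finset.univ : Finset ι).card
        ≤ Real.exp ((l * b) ^ 2 / 2) ^ (Finset.univ : Finset ι).card := by
          gcongr
          exact Real.cosh_le_exp_half_sq _
      _ = Real.exp (t ^ 2 / 2) := by
          rw [← Real.exp_nat_mul, Finset.card_univ, ← hNdef]
          congr 1
          have hsq : √N ^ 2 = N := Real.sq_sqrt (Nat.cast_nonneg _)
          rw [hl]; field_simp; rw [hsq, mul_comm]
  have hfin' := ENNReal.toReal_mono ENNReal.ofReal_ne_top hfin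
  rw [ENNReal.toReal_mul, ENNReal.toReal_ofReal (by positivity),
    ENNReal.toReal_ofReal (by positivity)] at hfin'
  rw [measureReal_def]
  have hE : Real.exp (t ^ 2 / 2) = Real.exp (t ^ 2) * Real.exp (-t ^ 2 / 2) := by
    rw [← Real.exp_add]; congr 1; ring
  rw [hE] at hfin'
  have := Real.exp_pos (t ^ 2)
  nlinarith

end Hoeffding

/-! ### Positive operators and Tikhonov regularization. -/

section Operators

variable {H : Type*} [NormedAddCommGroup H] [InnerProductSpace ℝ H]

/-- Pair `T x + η x` with `x`, drop `⟨T x, x⟩ ≥ 0`, and use Cauchy–Schwarz. -/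
theorem ContinuousLinearMap.IsPositive.mul_norm_le_norm_add_smul {T : H →L[ℝ] H}
    (hT : T.IsPositive) {η : ℝ} (x : H) :
    η * ‖x‖ ≤ ‖T x + η • x‖ := by
  rcases (norm_nonneg x).eq_or_lt with h | h
  · simp [← h]
  have h1 : 0 ≤ inner ℝ (T x) x := hT.inner_nonneg_left x
  have h2 : inner ℝ (T x + η • x) x = inner ℝ (T x) x + η * ‖x‖ ^ 2 := by
    rw [inner_add_left, real_inner_smul_left, real_inner_self_eq_norm_sq]
  have h3 := real_inner_le_norm (T x + η • x) x
  nlinarith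

theorem ContinuousLinearMap.IsPositive.norm_apply_le_norm_add_smul {T : H →L[ℝ] H}
    (hT : T.IsPositive) {η : ℝ} (hη : 0 ≤ η) (x : H) : ‖T x‖ ≤ ‖T x + η • x‖ := by
  have h1 : 0 ≤ inner ℝ (T x) x := hT.inner_nonneg_left x
  refine le_of_sq_le_sq ?_ (norm_nonneg _)
  rw [norm_add_sq_real, real_inner_smul_right]
  have := mul_nonneg hη h1
  nlinarith [sq_nonneg ‖η • x‖]

variable [CompleteSpace H]

theorem ContinuousLinearMap.IsPositive.isUnit_add_smul {T : H →L[ℝ] H}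
    (hT : T.IsPositive) {η : ℝ} (hη : 0 < η) : IsUnit (T + η • (1 : H →L[ℝ] H)) := by
  refine ContinuousLinearMap.isUnit_of_forall_le_norm_inner_map _ (c := ⟨η, hη.le⟩) hη fun x => ?_
  have h1 : 0 ≤ inner ℝ (T x) x := hT.inner_nonneg_left x
  have h2 : inner ℝ ((T + η • (1 : H →L[ℝ] H)) x) x = inner ℝ (T x) x + η * ‖x‖ ^ 2 := by
    simp [inner_add_left, real_inner_smul_left]
  rw [h2]
  refine le_trans ?_ (le_abs_self _)
  change ‖x‖ ^ 2 * η ≤ _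
  linarith

/-- Bessel-type bound for a diagonal operator along the eigenspaces of a symmetric operator. -/
theorem LinearMap.IsSymmetric.norm_sum_smul_starProjection_le {T : H →L[ℝ] H}
    (hT : (T : H →ₗ[ℝ] H).IsSymmetric) (s : Finset ℝ) (c : ℝ → ℝ) {M : ℝ} (hM : 0 ≤ M)
    (x : H) (hc : ∀ ν ∈ s,
      (T - ν • (1 : H →L[ℝ] H)).ker.starProjection x ≠ 0 → |c ν| ≤ M) :
    ‖∑ ν ∈ s, c ν • (T - ν • (1 : H →L[ℝ] H)).ker.starProjection x‖ ≤ M * ‖x‖ := by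
  set P : ℝ → H := fun ν => (T - ν • (1 : H →L[ℝ] H)).ker.starProjection x with hP
  have hmem : ∀ ν, T (P ν) = ν • P ν := fun ν => by
    have : P ν ∈ (T - ν • (1 : H →L[ℝ] H)).ker := Submodule.starProjection_apply_mem _ x
    simpa [sub_eq_zero] using this
  have hself : ∀ ν, inner ℝ (P ν) x = ‖P ν‖ ^ 2 := fun ν => by
    have h := Submodule.starProjection_inner_eq_zero (K := (T - ν • (1 : H →L[ℝ] H)).ker) x (P ν)
      (Submodule.starProjection_apply_mem _ x)
    rw [inner_sub_left, sub_eq_zero] at h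
    rw [real_inner_comm, h, real_inner_self_eq_norm_sq]
  have horth : ∀ ν ν', ν ≠ ν' → inner ℝ (P ν) (P ν') = 0 := fun ν ν' hne => by
    have h : inner ℝ (T (P ν)) (P ν') = inner ℝ (P ν) (T (P ν')) := hT (P ν) (P ν')
    rw [hmem, hmem, real_inner_smul_left, real_inner_smul_right] at h
    have h' : (ν - ν') * inner ℝ (P ν) (P ν') = 0 := by linarith
    exact (mul_eq_zero.1 h').resolve_left (sub_ne_zero.2 hne)
  have hsq : ∀ d : ℝ → ℝ, ‖∑ ν ∈ s, d ν • P ν‖ ^ 2 = ∑ ν ∈ s, d ν ^ 2 * ‖P ν‖ ^ 2 := fun d => by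
    rw [← real_inner_self_eq_norm_sq, sum_inner]
    refine Finset.sum_congr rfl fun ν hν => ?_
    rw [inner_sum, Finset.sum_eq_single_of_mem ν hν, real_inner_smul_left, real_inner_smul_right,
      real_inner_self_eq_norm_sq]
    · ring
    · intro ν' _ hne
      rw [real_inner_smul_left, real_inner_smul_right, horth _ _ hne.symm]; simp
  -- Expand `‖∑ P ν - x‖ ^ 2 ≥ 0`.
  have hbessel : ∑ ν ∈ s, ‖P ν‖ ^ 2 ≤ ‖x‖ ^ 2 := by
    have h1 := hsq fun _ => 1
    have h2 : inner ℝ (∑ ν ∈ s, P ν) x = ∑ ν ∈ s, ‖P ν‖ ^ 2 := by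
      rw [sum_inner]; exact Finset.sum_congr rfl fun ν _ => hself ν
    have h3 := norm_sub_sq_real (∑ ν ∈ s, P ν) x
    simp only [one_smul, one_pow, one_mul] at h1
    rw [h2, h1] at h3
    nlinarith [sq_nonneg ‖∑ ν ∈ s, P ν - x‖]
  refine le_of_sq_le_sq ?_ (by positivity)
  rw [hsq, mul_pow]
  calc ∑ ν ∈ s, c ν ^ 2 * ‖P ν‖ ^ 2 ≤ ∑ ν ∈ s, M ^ 2 * ‖P ν‖ ^ 2 := by
        refine Finset.sum_le_sum fun ν hν => ?_
        by_cases h : P ν = 0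
        · simp [h]
        · have := sq_le_sq' (abs_le.1 (hc ν hν h)).1 (abs_le.1 (hc ν hν h)).2
          gcongr
    _ ≤ M ^ 2 * ‖x‖ ^ 2 := by
        rw [← Finset.mul_sum]; gcongr

/-- Weighted AM–GM: `ν ^ β η ^ (1 - β) ≤ β ν + (1 - β) η ≤ ν + η`. -/
theorem Real.rpow_mul_div_add_le {β ν η : ℝ} (hβ0 : 0 ≤ β) (hβ1 : β ≤ 1) (hν : 0 ≤ ν)
    (hη : 0 < η) : η * ν ^ β / (ν + η) ≤ η ^ β := by
  rw [div_le_iff₀ (by positivity)]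
  have h := Real.geom_mean_le_arith_mean2_weighted hβ0 (sub_nonneg.2 hβ1) hν hη.le (by ring)
  have hsplit : η = η ^ β * η ^ (1 - β) := by
    rw [← Real.rpow_add hη]; simp
  calc η * ν ^ β = η ^ β * (ν ^ β * η ^ (1 - β)) := by
        nth_rewrite 1 [hsplit]; ring
    _ ≤ η ^ β * (ν + η) := by
        gcongr
        nlinarith

/-- The approximation error of Tikhonov regularization under a source condition. -/
theorem ContinuousLinearMap.IsPositive.norm_smul_le_of_add_smul_eq_spectralPow {T : H →L[ℝ] H}
    (hT : T.IsPositive) {η β : ℝ} (hη : 0 < η) (hβ0 : 0 ≤ β) (hβ1 : β ≤ 1) {g w : H}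
    (hw : T w + η • w = spectralPow T β g) : ‖η • w‖ ≤ η ^ β * ‖g‖ := by
  set P : ℝ → H := fun ν => (T - ν • (1 : H →L[ℝ] H)).ker.starProjection g with hP
  have hmem : ∀ ν, T (P ν) = ν • P ν := fun ν => by
    have : P ν ∈ (T - ν • (1 : H →L[ℝ] H)).ker := Submodule.starProjection_apply_mem _ g
    simpa [sub_eq_zero] using this
  have hnonneg : ∀ ν, P ν ≠ 0 → 0 ≤ ν := fun ν h => by
    have h1 : 0 ≤ inner ℝ (T (P ν)) (P ν) := hT.inner_nonneg_left _
    rw [hmem, real_inner_smul_left, real_inner_self_eq_norm_sq] at h1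
    exact nonneg_of_mul_nonneg_left h1 (by positivity)
  obtain ⟨R, hR⟩ := (hT.isUnit_add_smul hη).exists_left_inv
  have hRapp : ∀ x, R (T x + η • x) = x := fun x => by
    simpa using DFunLike.congr_fun hR x
  have hRP : ∀ ν, (η • R) (ν ^ β • P ν) = (η * ν ^ β / (ν + η)) • P ν := fun ν => by
    by_cases h : P ν = 0
    · simp [h]
    have hν := hnonneg ν h
    have hne : ν + η ≠ 0 := by positivity
    have h1 : R (P ν) = (ν + η)⁻¹ • P ν := by
      have := hRapp (P ν)
      rw [hmem, ← add_smul, map_smul] at this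
      rw [← this, smul_smul, this, inv_mul_cancel₀ hne, one_smul]
    rw [smul_apply, map_smul, h1, smul_smul, smul_smul, div_eq_mul_inv]
  have hηw : η • w = (η • R) (∑' ν, ν ^ β • P ν) := by
    have := hRapp w
    rw [hw] at this
    exact congrArg (η • ·) this.symm
  rw [hηw]
  -- Without summability the `tsum` defaults to `0`, so `η w = 0` and the bound is trivial;
  -- compactness of `T` is not needed.
  by_cases hs : Summable fun ν => ν ^ β • P ν
  · rw [(η • R).map_tsum hs]
    have hs' := hs.mapL (η • R)
    refine le_of_tendsto hs'.hasSum.norm (Filter.Eventually.of_forall fun s => ?_)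
    simp only [hRP]
    refine LinearMap.IsSymmetric.norm_sum_smul_starProjection_le hT.isSymmetric s _
      (by positivity) g fun ν _ hne => ?_
    have hν := hnonneg ν hne
    rw [abs_of_nonneg (by positivity)]
    exact Real.rpow_mul_div_add_le hβ0 hβ1 hν hη
  · rw [tsum_eq_zero_of_not_summable hs, map_zero, norm_zero]
    positivity

end Operators

/-! ### Feature maps, covariance operators and change of measure. -/

section KernelFeatures

variable {𝒵 H : Type*} [NormedAddCommGroup H] [InnerProductSpace ℝ H]
  [CompleteSpace H] [RKHS ℝ H 𝒵 ℝ]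

theorem inner_featureMap (z : 𝒵) (f : H) : inner ℝ (featureMap H z) f = f z := by
  simp [featureMap]

theorem inner_featureMap_featureMap (z z' : 𝒵) :
    inner ℝ (featureMap H z) (featureMap H z') = scalarKernel H z z' := by
  rw [inner_featureMap, scalarKernel, featureMap, RKHS.kerFun_apply]

/-- `‖φ(z) - φ(z₀)‖ ^ 2` is a combination of kernel values that vanishes at `z = z₀`. Continuity is
what makes `φ` measurable. -/
theorem continuous_featureMap [TopologicalSpace 𝒵]
    (hk : Continuous fun q : 𝒵 × 𝒵 => scalarKernel H q.1 q.2) :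
    Continuous (featureMap H : 𝒵 → H) := by
  rw [continuous_iff_continuousAt]
  intro z₀
  rw [ContinuousAt, tendsto_iff_norm_sub_tendsto_zero]
  have hsq : ∀ z, ‖featureMap H z - featureMap H z₀‖ =
      √(scalarKernel H z z - 2 * scalarKernel H z z₀ + scalarKernel H z₀ z₀) := fun z => by
    rw [← Real.sqrt_sq (norm_nonneg (featureMap H z - featureMap H z₀)), norm_sub_sq_real,
      ← real_inner_self_eq_norm_sq, ← real_inner_self_eq_norm_sq]
    simp only [inner_featureMap_featureMap]
  have h1 : Continuous fun z : 𝒵 => scalarKernel H z z :=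
    Continuous.comp (g := fun q : 𝒵 × 𝒵 => scalarKernel H q.1 q.2) (f := fun z => (z, z)) hk
      (by fun_prop)
  have h2 : Continuous fun z : 𝒵 => scalarKernel H z z₀ :=
    Continuous.comp (g := fun q : 𝒵 × 𝒵 => scalarKernel H q.1 q.2) (f := fun z => (z, z₀)) hk
      (by fun_prop)
  have hcont : Continuous fun z =>
      √(scalarKernel H z z - 2 * scalarKernel H z z₀ + scalarKernel H z₀ z₀) := by fun_prop
  have h0 : scalarKernel H z₀ z₀ - 2 * scalarKernel H z₀ z₀ + scalarKernel H z₀ z₀ = 0 := by ring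
  have hlim := hcont.tendsto z₀
  rw [h0, Real.sqrt_zero] at hlim
  exact hlim.congr fun z => (hsq z).symm

theorem empCovOperator_apply {n : ℕ} (z : Fin n → 𝒵) (v : H) :
    empCovOperator H z v =
      (n : ℝ)⁻¹ • ∑ i, inner ℝ (featureMap H (z i)) v • featureMap H (z i) := by
  simp [empCovOperator]

theorem isPositive_empCovOperator {n : ℕ} (z : Fin n → 𝒵) : (empCovOperator H z).IsPositive := by
  rw [ContinuousLinearMap.isPositive_iff]
  refine ⟨fun x y => ?_, fun x => ?_⟩
  · simp only [ContinuousLinearMap.coe_coe, empCovOperator_apply, real_inner_smul_left,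
      real_inner_smul_right, sum_inner, inner_sum]
    congr 1
    refine Finset.sum_congr rfl fun i _ => ?_
    rw [real_inner_comm x]; ring
  · simp only [empCovOperator_apply, real_inner_smul_left, sum_inner]
    exact mul_nonneg (by positivity) (Finset.sum_nonneg fun i _ => mul_self_nonneg _)

section Covariance

variable [MeasurableSpace 𝒵] {ν : Measure 𝒵} [IsFiniteMeasure ν] {κ : ℝ}

theorem integrable_rankOne_featureMap (hφ : AEStronglyMeasurable (featureMap H : 𝒵 → H) ν)
    (hb : ∀ᵐ z ∂ν, ‖featureMap H z‖ ≤ κ) :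
    Integrable (fun z => InnerProductSpace.rankOne ℝ (featureMap H z) (featureMap H z)) ν := by
  have hc : Continuous fun x : H => InnerProductSpace.rankOne ℝ x x :=
    (InnerProductSpace.rankOne ℝ (E := H) (F := H)).continuous₂.comp
      (continuous_id.prodMk continuous_id)
  refine Integrable.of_bound (hc.comp_aestronglyMeasurable hφ) (κ * κ) ?_
  filter_upwards [hb] with z hz
  rw [InnerProductSpace.norm_rankOne]
  exact mul_le_mul hz hz (norm_nonneg _) ((norm_nonneg _).trans hz)

theorem covOperator_apply (hφ : AEStronglyMeasurable (featureMap H : 𝒵 → H) ν)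
    (hb : ∀ᵐ z ∂ν, ‖featureMap H z‖ ≤ κ) (v : H) :
    covOperator H ν v = ∫ z, inner ℝ (featureMap H z) v • featureMap H z ∂ν := by
  rw [covOperator, ContinuousLinearMap.integral_apply (integrable_rankOne_featureMap hφ hb)]
  simp

theorem integrable_inner_smul_featureMap (hφ : AEStronglyMeasurable (featureMap H : 𝒵 → H) ν)
    (hb : ∀ᵐ z ∂ν, ‖featureMap H z‖ ≤ κ) (v : H) :
    Integrable (fun z => inner ℝ (featureMap H z) v • featureMap H z) ν := by
  simpa using (integrable_rankOne_featureMap hφ hb).apply_continuousLinearMap v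

theorem isPositive_covOperator (hφ : AEStronglyMeasurable (featureMap H : 𝒵 → H) ν)
    (hb : ∀ᵐ z ∂ν, ‖featureMap H z‖ ≤ κ) : (covOperator H ν).IsPositive := by
  have hinner : ∀ x y : H, inner ℝ (covOperator H ν x) y =
      ∫ z, inner ℝ (featureMap H z) x * inner ℝ (featureMap H z) y ∂ν := fun x y => by
    rw [real_inner_comm, covOperator_apply hφ hb,
      ← integral_inner (integrable_inner_smul_featureMap hφ hb x)]
    simp only [real_inner_smul_right, real_inner_comm y]
  rw [ContinuousLinearMap.isPositive_iff]
  refine ⟨fun x y => ?_, fun x => ?_⟩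
  · simp only [ContinuousLinearMap.coe_coe]
    rw [real_inner_comm _ x, hinner, hinner]
    simp only [mul_comm]
  · rw [hinner]
    exact integral_nonneg fun z => mul_self_nonneg _

/-- Change of measure: the mean embedding of `Q` is the covariance operator of `ν` applied to the
density ratio `dQ / dν`. -/
theorem kernelMean_eq_covOperator_apply (hφ : AEStronglyMeasurable (featureMap H : 𝒵 → H) ν)
    (hb : ∀ᵐ z ∂ν, ‖featureMap H z‖ ≤ κ) {Q : Measure 𝒵} [IsFiniteMeasure Q] {r : H}
    (hr : IsDensityRatio Q ν r) : kernelMean H Q = covOperator H ν r := by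
  rw [covOperator_apply hφ hb, kernelMean, ← integral_rnDeriv_smul hr.1]
  refine integral_congr_ae ?_
  filter_upwards [hr.2] with z hz
  rw [inner_featureMap, hz]

end Covariance

end KernelFeatures

/-! ### Stability of the estimator and concentration of `Ĉ v`. -/

section Estimator

variable {𝒵 H : Type*} [NormedAddCommGroup H] [InnerProductSpace ℝ H]
  [CompleteSpace H] [RKHS ℝ H 𝒵 ℝ]

/-- The error of the KuLSIF estimator around any `r`, in terms of its residual. -/
theorem norm_kulsif_sub_le {n : ℕ} (z : Fin n → 𝒵) {η : ℝ} (hη : 0 < η) (m r : H) :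
    ‖kulsif η z m - r‖ ≤ 1 / η * ‖m - (empCovOperator H z r + η • r)‖ := by
  set A := empCovOperator H z + η • (1 : H →L[ℝ] H) with hA
  have hinv : A * Ring.inverse A = 1 :=
    Ring.mul_inverse_cancel A (isUnit_empCovOperator_add H z hη)
  have happ : A (kulsif η z m) = m := DFunLike.congr_fun hinv m
  have hAx : ∀ x, A x = empCovOperator H z x + η • x := fun x => by simp [hA]
  have h := (isPositive_empCovOperator (H := H) z).mul_norm_le_norm_add_smul (η := η)
    (kulsif η z m - r)
  rw [← hAx, map_sub, happ, hAx] at h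
  rw [one_div, ← div_eq_inv_mul, le_div_iff₀ hη]
  linarith

variable [TopologicalSpace 𝒵] [MeasurableSpace 𝒵] [BorelSpace 𝒵]
  [TopologicalSpace.SeparableSpace H]

/-- Concentration of the empirical covariance operator, applied to a fixed vector. -/
theorem measureReal_norm_covOperator_sub_empCovOperator_gt_le
    {Ω : Type*} [MeasurableSpace Ω] {μ : Measure Ω} [IsProbabilityMeasure μ]
    {ν : Measure 𝒵} [IsProbabilityMeasure ν]
    (hφ : Continuous (featureMap H : 𝒵 → H)) {κ : ℝ} (hb : ∀ᵐ z ∂ν, ‖featureMap H z‖ ≤ κ)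
    {n : ℕ} (hn : 0 < n) {Z : Fin n → Ω → 𝒵} (hlaw : ∀ i, HasLaw (Z i) ν μ)
    (hindep : iIndepFun Z μ) (v : H) {R : ℝ} (hR : ‖v‖ ≤ R) {t : ℝ} (ht : 0 ≤ t) :
    μ.real {ω | 2 * κ ^ 2 * R * t / √n <
        ‖covOperator H ν v - empCovOperator H (fun i => Z i ω) v‖}
      ≤ 2 * Real.exp (-t ^ 2 / 2) := by
  borelize H
  have hsec : SecondCountableTopology H := UniformSpace.secondCountable_of_separable H
  have hφm : AEStronglyMeasurable (featureMap H : 𝒵 → H) ν := hφ.aestronglyMeasurable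
  set m := covOperator H ν v with hm
  have hmint : m = ∫ z, inner ℝ (featureMap H z) v • featureMap H z ∂ν :=
    covOperator_apply hφm hb v
  have hint := integrable_inner_smul_featureMap hφm hb v
  have hξ : ∀ᵐ z ∂ν, ‖inner ℝ (featureMap H z) v • featureMap H z‖ ≤ κ ^ 2 * R := by
    filter_upwards [hb] with z hz
    have hκ : 0 ≤ κ := (norm_nonneg _).trans hz
    have hR0 : 0 ≤ R := (norm_nonneg _).trans hR
    calc ‖inner ℝ (featureMap H z) v • featureMap H z‖
        ≤ ‖featureMap H z‖ * ‖v‖ * ‖featureMap H z‖ := by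
          rw [norm_smul]; gcongr; exact norm_inner_le_norm _ _
      _ ≤ κ * R * κ := by gcongr
      _ = κ ^ 2 * R := by ring
  have hmnorm : ‖m‖ ≤ κ ^ 2 * R := by
    have := norm_integral_le_of_norm_le_const hξ
    simpa [← hmint] using this
  set f : 𝒵 → H := fun z => inner ℝ (featureMap H z) v • featureMap H z - m with hf
  have hfm : Measurable f := by
    refine Continuous.measurable ?_
    fun_prop
  have hfmean : ∫ z, f z ∂ν = 0 := by
    rw [hf, integral_sub hint (integrable_const m), ← hmint]
    simp
  -- Centring doubles the almost sure bound `κ ^ 2 R`.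
  have hconc := measureReal_norm_sum_gt_le (μ := μ) (Y := fun i ω => f (Z i ω))
    (b := 2 * (κ ^ 2 * R))
    (fun i => hfm.comp_aemeasurable (hlaw i).aemeasurable)
    (hindep.comp (fun _ => f) fun _ => hfm)
    (fun i => by
      have h1 : ∀ᵐ z ∂ν, ‖f z‖ ≤ 2 * (κ ^ 2 * R) := by
        filter_upwards [hξ] with z hz
        have := norm_sub_le (inner ℝ (featureMap H z) v • featureMap H z) m
        linarith
      rw [← (hlaw i).map_eq] at h1
      exact ae_of_ae_map (hlaw i).aemeasurable h1)
    (fun i => ((hlaw i).integral_comp hfm.aestronglyMeasurable).trans hfmean) ht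
  refine le_trans (measureReal_mono fun ω hω => ?_) hconc
  have hn' : (0 : ℝ) < n := Nat.cast_pos.2 hn
  have hsum : ∑ i, f (Z i ω) = (n : ℝ) • (empCovOperator H (fun i => Z i ω) v - m) := by
    rw [empCovOperator_apply, smul_sub, smul_inv_smul₀ hn'.ne']
    simp [hf, Finset.sum_sub_distrib, Nat.cast_smul_eq_nsmul]
  simp only [Set.mem_ofPred_eq] at hω ⊢
  rw [hsum, norm_smul, Real.norm_of_nonneg hn'.le, Fintype.card_fin, norm_sub_rev]
  calc 2 * (κ ^ 2 * R) * √(n : ℝ) * t = n * (2 * κ ^ 2 * R * t / √n) := by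
        nth_rewrite 2 [← Real.mul_self_sqrt hn'.le]
        have := Real.sqrt_pos.2 hn'
        field_simp
    _ < _ := by gcongr

end Estimator

/-! ### The error bound. -/

theorem mainTheorem2
    {𝒳 𝒵 Ω H : Type*}
    [MeasurableSpace 𝒳]
    [TopologicalSpace 𝒵] [MeasurableSpace 𝒵] [BorelSpace 𝒵]
    [MeasurableSpace Ω]
    [NormedAddCommGroup H] [InnerProductSpace ℝ H] [CompleteSpace H]
    [TopologicalSpace.SeparableSpace H] [RKHS ℝ H 𝒵 ℝ]
    -- the data distribution on `𝒳 × 𝒵`, and the prior on `𝒵`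
    (P : Measure (𝒳 × 𝒵)) [IsProbabilityMeasure P]
    (prior : Measure 𝒵) [IsProbabilityMeasure prior]
    -- the kernel is continuous and bounded
    (hk_cont : Continuous fun q : 𝒵 × 𝒵 => scalarKernel H q.1 q.2)
    (κ₁ : ℝ) (hk_bdd : ∀ᵐ z ∂P.snd, ‖featureMap H z‖ ≤ κ₁)
    -- the density ratio lies in `H` and satisfies the source condition `r₀ = C ^ β₁ g₁`
    (r₀ : H) (hr₀ : IsDensityRatio prior P.snd r₀)
    (β₁ ζ₁ : ℝ) (hβ₁ : β₁ ∈ Set.Ioc (0 : ℝ) (1 / 2))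
    (hsource : ∃ g₁ : H, r₀ = spectralPow (covOperator H P.snd) β₁ g₁ ∧ ‖g₁‖ ≤ ζ₁)
    -- the i.i.d. sample `(xᵢ, zᵢ) ∼ P`
    (μ : Measure Ω) [IsProbabilityMeasure μ]
    (n : ℕ) (hn : 0 < n) (D : Fin n → Ω → 𝒳 × 𝒵)
    (hD_law : ∀ i, HasLaw (D i) P μ) (hD_indep : iIndepFun D μ)
    -- an arbitrary, possibly data-dependent, estimate of the prior embedding
    (mhat : Ω → H)
    (η : ℝ) (hη : 0 < η)
    (δ : ℝ) (hδ : δ ∈ Set.Ioo (0 : ℝ) (2 / Real.exp 1)) :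
    1 - δ ≤ μ.real {ω |
      ‖kulsif η (fun i => (D i ω).2) (mhat ω) - r₀‖ ≤
        1 / η * (4 * κ₁ ^ 2 * ‖r₀‖ * Real.log (2 / δ) / √(n : ℝ)
            + ‖mhat ω - kernelMean H prior‖)
          + η ^ β₁ * ζ₁} := by
  have hφ : Continuous (featureMap H : 𝒵 → H) := continuous_featureMap hk_cont
  have hsec : SecondCountableTopology H := UniformSpace.secondCountable_of_separable H
  have hφm : AEStronglyMeasurable (featureMap H : 𝒵 → H) P.snd := hφ.aestronglyMeasurable
  set C := covOperator H P.snd with hC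
  have hpos : C.IsPositive := isPositive_covOperator hφm hk_bdd
  obtain ⟨g₁, hg₁, hζ₁⟩ := hsource
  obtain ⟨w, hw⟩ : ∃ w, C w + η • w = r₀ := by
    obtain ⟨R, hR⟩ := (hpos.isUnit_add_smul hη).exists_right_inv
    exact ⟨R r₀, by simpa using DFunLike.congr_fun hR r₀⟩
  -- `C w = (C + η)⁻¹ C r₀` is the population estimator
  have hbias : ‖C w - r₀‖ ≤ η ^ β₁ * ζ₁ := by
    have h : C w - r₀ = -(η • w) := by rw [← hw]; abel
    rw [h, norm_neg]
    exact (hpos.norm_smul_le_of_add_smul_eq_spectralPow hη hβ₁.1.le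
      (hβ₁.2.trans (by norm_num)) (hw.trans hg₁)).trans (by gcongr)
  have hCw : ‖C w‖ ≤ ‖r₀‖ := hw ▸ hpos.norm_apply_le_norm_add_smul hη.le w
  have hmean : kernelMean H prior = C (C w) + η • C w := by
    rw [kernelMean_eq_covOperator_apply hφm hk_bdd hr₀, ← hC, ← hw, map_add, map_smul]
  have hlog : 1 ≤ Real.log (2 / δ) := by
    rw [Real.le_log_iff_exp_le (div_pos two_pos hδ.1), le_div_iff₀ hδ.1, mul_comm,
      ← le_div_iff₀ (Real.exp_pos 1)]
    exact hδ.2.le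
  set L := Real.log (2 / δ) with hL
  have hlaw : ∀ i, HasLaw (fun ω => (D i ω).2) P.snd μ := fun i =>
    (⟨measurable_snd.aemeasurable, rfl⟩ : HasLaw Prod.snd P.snd P).comp (hD_law i)
  -- `t = 2 L` produces the constant `4`; the tail `2 exp (-2 L ^ 2)` is at most `2 exp (-L) = δ`
  -- because `L ≥ 1`, which is where `δ < 2 / e` enters.
  have hconc := measureReal_norm_covOperator_sub_empCovOperator_gt_le hφ hk_bdd hn hlaw
    (hD_indep.comp (fun _ => Prod.snd) fun _ => measurable_snd) (C w) hCw
    (t := 2 * L) (by linarith)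
  have htail : 2 * Real.exp (-(2 * L) ^ 2 / 2) ≤ δ := by
    calc 2 * Real.exp (-(2 * L) ^ 2 / 2) ≤ 2 * Real.exp (-L) := by
          gcongr; nlinarith
      _ = δ := by
          rw [hL, Real.exp_neg, Real.exp_log (div_pos two_pos hδ.1)]
          field_simp
  set bad := {ω | 2 * κ₁ ^ 2 * ‖r₀‖ * (2 * L) / √n <
    ‖C (C w) - empCovOperator H (fun i => (D i ω).2) (C w)‖} with hbad
  refine le_trans ?_ (measureReal_mono (s₁ := badᶜ) fun ω hω => ?_)
  -- Subadditivity suffices here, so neither `bad` nor `mhat` has to be measurable.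
  · have hunion := measureReal_union_le (μ := μ) bad badᶜ
    rw [Set.union_compl_self, probReal_univ] at hunion
    have : μ.real bad ≤ δ := hconc.trans htail
    linarith
  · have hω' : ‖C (C w) - empCovOperator H (fun i => (D i ω).2) (C w)‖ ≤
        4 * κ₁ ^ 2 * ‖r₀‖ * L / √n := by
      simp only [hbad, Set.mem_compl_iff, Set.mem_ofPred_eq, not_lt] at hω
      refine hω.trans (le_of_eq ?_)
      ring
    have hres : mhat ω - (empCovOperator H (fun i => (D i ω).2) (C w) + η • C w) =
        (C (C w) - empCovOperator H (fun i => (D i ω).2) (C w))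
          + (mhat ω - kernelMean H prior) := by
      rw [hmean]; abel
    have hvar := norm_kulsif_sub_le (fun i => (D i ω).2) hη (mhat ω) (C w)
    rw [hres] at hvar
    rw [Set.mem_ofPred_eq]
    calc ‖kulsif η (fun i => (D i ω).2) (mhat ω) - r₀‖
        ≤ ‖kulsif η (fun i => (D i ω).2) (mhat ω) - C w‖ + ‖C w - r₀‖ :=
          norm_sub_le_norm_sub_add_norm_sub _ _ _
      _ ≤ _ := by
          refine add_le_add (hvar.trans ?_) hbias
          gcongr
          exact (norm_add_le _ _).trans (by gcongr)
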